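/- **Theorem (GradNorm stabilizes gradient distributions across time, for the simplified transformer block).** *Block.* Fix a query token $q$, a context embedding matrix $U_C\in\mathbb R^{d\times M_C}$, a query embedding $u_q\in\mathbb R^d$ and a scalar activation $\phi$. For an input $x\in\mathbb R^{M_C}$, attention logits $z_q\in\mathbb R^{M_C\times 1}$ and weights $W\in\mathbb R^{d\times n}$, the block computes $$f=U_C\big(\exp(z_q)\odot x\big)+u_q,\qquad h=\phi(W^\top f)\in\mathbb R^n .$$ A data point $p$ has an input $x_p$ and a loss function $\ell_p:\mathbb R^n\to\mathbb R$. The loss of a mini-batch $D=(p_1,\dots,p_B)$, all of whose points have the query $q$, is $\mathcal L_{W,z_q}(D)=\frac1B\sum_b \ell_{p_b}(h_{p_b})$. Write $V=U_C^\top W$ and let $g_{h}=\nabla_h\ell_p$ and $h'=\phi'(W^\top f)$. *Processing.* For $G\in\mathbb R^{m\times n}$ let $\mathtt{GradNorm}(G)_{ij}=(G_{ij}-\bar g_i)/s_i$ with $\bar g_i=\frac1n\sum_jG_{ij}$ and $s_i=\sqrt{\frac1n\sum_j(G_{ij}-\bar g_i)^2}$, where a row with $s_i=0$ is sent to the zero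 row. *Assumptions.* Let $(W^{(t)},z_q^{(t)})$ be the parameters and $D^{(t)}$ the random mini-batch at time $t$. The parameters may be random, and nothing is assumed about how they are generated, so they may follow the mini-batch or the full-batch gradient dynamics. Assume: 1. (orthonormal embeddings) $U_C^\top U_C=I$ and $U_C^\top u_q=0$; 2. (differentiability) for each $t$, almost surely, for every point of $D^{(t)}$, $\phi$ is differentiable at the pre-activations and $\ell_p$ at the output; 3. (stationary back-propagated gradient with mini-batch noise) there are a matrix $\mu\in\mathbb R^{M_C\times n}$ that does not depend on $t$ and random matrices $\xi^{(t)}$ such that for each $t$, almost surely, for all $i,j$, $$\frac1B\sum_{b} (g_{h_j}h'_j)(p_b)\,x_{p_b,i}=\mu_{ij}+\xi^{(t)}_{ij},$$ and for each $i$ the row $\xi^{(t)}[i,:]$ has the same law for all $t$ (for instance, the $\xi^{(t)}$ are i.i.d. over $t$ and centred, in which case $\mu$ is the mean of the left-hand side). *Conclusion.* Let $\tilde G_V^{(t)}=\mathtt{GradNorm}\big(\partial\mathcal L_{W^{(t)},z_q^{(t)}}(D^{(t)})/\partial V\big)\in\mathbb R^{M_C\times n}$, where the derivative with respect to $V$ is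 taken with the component of $W$ orthogonal to the range of $U_C$ held fixed. Its entries are square integrable and $$\mathrm{Cov}\big[\tilde G_V^{(t_1)}[i,:]\big]=\mathrm{Cov}\big[\tilde G_V^{(t_2)}[i,:]\big]\qquad\text{for all }t_1,t_2\text{ and all }i .$$ The same two assertions hold for $\tilde G_{z_q}^{(t)}=\mathtt{GradNorm}\big(\partial\mathcal L_{W^{(t)},z_q^{(t)}}(D^{(t)})/\partial z_q\big)\in\mathbb R^{M_C\times 1}$ (here each row has a single entry, so the standard deviations are $0$ and the convention for such rows applies). -/

import Mathlib

open MeasureTheory ProbabilityTheory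
open scoped Matrix

noncomputable section

/-- Data of a simplified transformer block with a fixed query token `q`: the context embedding
matrix `U_C` (size `d × M`), the query embedding `u_q` and the scalar activation function. -/
structure STB (d M : ℕ) where
  UC : Matrix (Fin d) (Fin M) ℝ
  uq : Fin d → ℝ
  φ : ℝ → ℝ

/-- Orthonormal embeddings: `U_Cᵀ U_C = I` and `U_Cᵀ u_q = 0`. -/
def STB.OrthonormalEmbeddings {d M : ℕ} (S : STB d M) : Prop :=
  S.UCᵀ * S.UC = 1 ∧ S.UCᵀ *ᵥ S.uq = 0

/-- `f = U_C (exp(z_q) ⊙ x) + u_q`. -/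
def STB.feature {d M : ℕ} (S : STB d M) (z x : Fin M → ℝ) : Fin d → ℝ :=
  S.UC *ᵥ (fun l => Real.exp (z l) * x l) + S.uq

/-- The pre-activation `Wᵀ f` of the hidden nodes. -/
def STB.preact {d M n : ℕ} (S : STB d M) (W : Matrix (Fin d) (Fin n) ℝ) (z x : Fin M → ℝ) :
    Fin n → ℝ :=
  Wᵀ *ᵥ S.feature z x

/-- The output `h = φ(Wᵀ f)` of the block, with `φ` applied entrywise. -/
def STB.output {d M n : ℕ} (S : STB d M) (W : Matrix (Fin d) (Fin n) ℝ) (z x : Fin M → ℝ) :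
    Fin n → ℝ :=
  fun j => S.φ (S.preact W z x j)

/-- The loss on a mini-batch `D` of `B` data points. A data point `p : 𝒟` (all of them have the
query token `q`) has input activation `act p` and contributes `ℓ p h` when the block outputs `h`,
so that targets and the rest of the network are part of `ℓ p`. -/
def STB.batchLoss {d M n B : ℕ} {𝒟 : Type*} (S : STB d M) (act : 𝒟 → Fin M → ℝ)
    (ℓ : 𝒟 → (Fin n → ℝ) → ℝ) (W : Matrix (Fin d) (Fin n) ℝ) (z : Fin M → ℝ)
    (D : Fin B → 𝒟) : ℝ :=
  (B : ℝ)⁻¹ * ∑ b, ℓ (D b) (S.output W z (act (D b)))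

/-- The gradient of the mini-batch loss with respect to `V = U_Cᵀ W`. Entry `(i, j)` is the
derivative along `W + s • (U_C E_{ij})`: when `U_Cᵀ U_C = I` this moves `V` to `V + s E_{ij}` and
keeps the part of `W` that is orthogonal to the range of `U_C`. -/
def STB.gradV {d M n B : ℕ} {𝒟 : Type*} (S : STB d M) (act : 𝒟 → Fin M → ℝ)
    (ℓ : 𝒟 → (Fin n → ℝ) → ℝ) (W : Matrix (Fin d) (Fin n) ℝ) (z : Fin M → ℝ)
    (D : Fin B → 𝒟) : Matrix (Fin M) (Fin n) ℝ :=
  Matrix.of fun i j =>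
    deriv (fun s : ℝ => S.batchLoss act ℓ (W + s • (S.UC * Matrix.single i j (1 : ℝ))) z D) 0

/-- The gradient of the mini-batch loss with respect to the attention logits `z_q`, which are a
column vector, that is, an `M × 1` matrix. -/
def STB.gradLogits {d M n B : ℕ} {𝒟 : Type*} (S : STB d M) (act : 𝒟 → Fin M → ℝ)
    (ℓ : 𝒟 → (Fin n → ℝ) → ℝ) (W : Matrix (Fin d) (Fin n) ℝ) (z : Fin M → ℝ)
    (D : Fin B → 𝒟) : Matrix (Fin M) (Fin 1) ℝ :=
  Matrix.of fun i _ =>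
    deriv (fun s : ℝ => S.batchLoss act ℓ W (z + s • Pi.single i (1 : ℝ)) D) 0

/-- The gradient that is back-propagated to the hidden node `j` at the data point `p`, namely
`g_{h_j} h_j'` with `g_h = ∇_h ℓ` and `h_j' = φ'((Wᵀ f)_j)`; it is `g_{h_j}` if `φ` is linear. -/
def STB.backprop {d M n : ℕ} {𝒟 : Type*} (S : STB d M) (act : 𝒟 → Fin M → ℝ)
    (ℓ : 𝒟 → (Fin n → ℝ) → ℝ) (W : Matrix (Fin d) (Fin n) ℝ) (z : Fin M → ℝ)
    (p : 𝒟) (j : Fin n) : ℝ :=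
  fderiv ℝ (ℓ p) (S.output W z (act p)) (Pi.single j 1) * deriv S.φ (S.preact W z (act p) j)

/-- The mini-batch average of `g_{h_j} h_j' x_i`. -/
def STB.backpropSignal {d M n B : ℕ} {𝒟 : Type*} (S : STB d M) (act : 𝒟 → Fin M → ℝ)
    (ℓ : 𝒟 → (Fin n → ℝ) → ℝ) (W : Matrix (Fin d) (Fin n) ℝ) (z : Fin M → ℝ)
    (D : Fin B → 𝒟) : Matrix (Fin M) (Fin n) ℝ :=
  Matrix.of fun i j => (B : ℝ)⁻¹ * ∑ b, S.backprop act ℓ W z (D b) j * act (D b) i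

/-- The loss is differentiable through the block at the data point `p`. -/
def STB.SmoothAt {d M n : ℕ} {𝒟 : Type*} (S : STB d M) (act : 𝒟 → Fin M → ℝ)
    (ℓ : 𝒟 → (Fin n → ℝ) → ℝ) (W : Matrix (Fin d) (Fin n) ℝ) (z : Fin M → ℝ) (p : 𝒟) : Prop :=
  (∀ j, DifferentiableAt ℝ S.φ (S.preact W z (act p) j)) ∧
    DifferentiableAt ℝ (ℓ p) (S.output W z (act p))

/-- The mean of row `i` of `G`. -/
def rowMean {m n : ℕ} (G : Matrix (Fin m) (Fin n) ℝ) (i : Fin m) : ℝ :=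
  (1 / (n : ℝ)) * ∑ j, G i j

/-- The standard deviation of row `i` of `G`. -/
def rowStd {m n : ℕ} (G : Matrix (Fin m) (Fin n) ℝ) (i : Fin m) : ℝ :=
  Real.sqrt ((1 / (n : ℝ)) * ∑ j, (G i j - rowMean G i) ^ 2)

/-- Row-wise standardization. A row with standard deviation `0` is sent to the zero row. -/
def gradNorm {m n : ℕ} (G : Matrix (Fin m) (Fin n) ℝ) : Matrix (Fin m) (Fin n) ℝ :=
  Matrix.of fun i j => (G i j - rowMean G i) / rowStd G i

/-- The covariance matrix of row `i` of a random matrix `G`. -/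
def rowCov {Ω : Type*} [MeasurableSpace Ω] (P : Measure Ω) {m n : ℕ}
    (G : Ω → Matrix (Fin m) (Fin n) ℝ) (i : Fin m) : Matrix (Fin n) (Fin n) ℝ :=
  Matrix.of fun j k => covariance (fun ω => G ω i j) (fun ω => G ω i k) P

end

/-!
With `U_Cᵀ U_C = 1` and `U_Cᵀ u_q = 0`, the feature satisfies `U_Cᵀ f = exp(z) ⊙ x`, so moving `V`
along `E_{ij}` moves the pre-activation `j` at speed `exp(z i) * x i` and leaves the others fixed.
The chain rule therefore makes row `i` of the `V`-gradient equal to `exp(z i)` times row `i` of the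
back-propagated signal (`STB.gradV_row_eq`). Row standardization is invariant under positive
scaling (`standardize_smul`), so the logits, the only part of the parameters that is not already in
the signal, disappear: almost surely the normalized row is a fixed function of row `i` of `μ + ξ`.
That function is measurable and bounded by `√n`, so the normalized row is square integrable, and it
inherits from the noise a law that does not depend on time; its covariance is determined by that
law.

The logit gradient has rows of length one, and standardizing such a row gives zero.
-/

/-! ### Row standardization -/

/-- Standardization of a single vector, as the normalization of a matrix with one row. -/
noncomputable def standardize {n : ℕ} (v : Fin n → ℝ) : Fin n → ℝ :=
  gradNorm (Matrix.of fun _ : Fin 1 => v) 0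

theorem gradNorm_row {m n : ℕ} (G : Matrix (Fin m) (Fin n) ℝ) (i : Fin m) :
    gradNorm G i = standardize (G i) :=
  rfl

theorem standardize_smul {n : ℕ} {c : ℝ} (hc : 0 < c) (v : Fin n → ℝ) :
    standardize (c • v) = standardize v := by
  have hmean : rowMean (Matrix.of fun _ : Fin 1 => c • v) 0 =
      c * rowMean (Matrix.of fun _ : Fin 1 => v) 0 := by
    simp only [rowMean, Matrix.of_apply, Pi.smul_apply, smul_eq_mul, ← Finset.mul_sum]
    ring
  have hstd : rowStd (Matrix.of fun _ : Fin 1 => c • v) 0 =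
      c * rowStd (Matrix.of fun _ : Fin 1 => v) 0 := by
    simp only [rowStd, hmean, Matrix.of_apply, Pi.smul_apply, smul_eq_mul, ← mul_sub, mul_pow,
      ← Finset.mul_sum]
    rw [mul_left_comm, Real.sqrt_mul (sq_nonneg c), Real.sqrt_sq hc.le]
  funext j
  simp only [standardize, gradNorm, hmean, hstd, Matrix.of_apply, Pi.smul_apply, smul_eq_mul,
    ← mul_sub]
  exact mul_div_mul_left _ _ hc.ne'

/-- A single entry contributes at most `n` times the mean square deviation. -/
theorem abs_standardize_le {n : ℕ} (v : Fin n → ℝ) (j : Fin n) :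
    |standardize v j| ≤ Real.sqrt n := by
  have hn : (0 : ℝ) < n := by exact_mod_cast j.pos
  set G : Matrix (Fin 1) (Fin n) ℝ := Matrix.of fun _ => v
  have hdev : |G 0 j - rowMean G 0| ≤ Real.sqrt n * rowStd G 0 := by
    rw [rowStd, ← Real.sqrt_mul hn.le, ← mul_assoc, mul_one_div_cancel hn.ne', one_mul]
    exact Real.abs_le_sqrt (Finset.single_le_sum (f := fun k => (G 0 k - rowMean G 0) ^ 2)
      (fun k _ => sq_nonneg _) (Finset.mem_univ j))
  have hstd : 0 ≤ rowStd G 0 := Real.sqrt_nonneg _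
  change |(G 0 j - rowMean G 0) / rowStd G 0| ≤ _
  rw [abs_div, abs_of_nonneg hstd]
  exact div_le_of_le_mul₀ hstd (Real.sqrt_nonneg _) hdev

theorem measurable_standardize {n : ℕ} :
    Measurable (standardize : (Fin n → ℝ) → Fin n → ℝ) := by
  refine measurable_pi_lambda _ fun j => ?_
  simp only [standardize, gradNorm, rowStd, rowMean, Matrix.of_apply]
  fun_prop

theorem gradNorm_single_column {m : ℕ} (G : Matrix (Fin m) (Fin 1) ℝ) : gradNorm G = 0 := by
  ext i j
  simp [gradNorm, rowMean, Subsingleton.elim j 0]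

/-! ### The gradient with respect to `V` -/

/-- Orthonormality of the embeddings makes `U_Cᵀ` recover the attention-weighted input. -/
theorem STB.transpose_mulVec_feature {d M : ℕ} {S : STB d M} (hS : S.OrthonormalEmbeddings)
    (z x : Fin M → ℝ) : S.UCᵀ *ᵥ S.feature z x = fun l => Real.exp (z l) * x l := by
  rw [STB.feature, Matrix.mulVec_add, Matrix.mulVec_mulVec, hS.1, hS.2, Matrix.one_mulVec,
    add_zero]

theorem STB.preact_add_smul {d M n : ℕ} {S : STB d M} (hS : S.OrthonormalEmbeddings)
    (W : Matrix (Fin d) (Fin n) ℝ) (z x : Fin M → ℝ) (i : Fin M) (j : Fin n) (s : ℝ) :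
    S.preact (W + s • (S.UC * Matrix.single i j (1 : ℝ))) z x =
      S.preact W z x + s • Pi.single j (Real.exp (z i) * x i) := by
  rw [STB.preact, Matrix.transpose_add, Matrix.add_mulVec, Matrix.transpose_smul,
    Matrix.smul_mulVec, Matrix.transpose_mul, ← Matrix.mulVec_mulVec,
    STB.transpose_mulVec_feature hS, Matrix.transpose_single, Matrix.single_mulVec, one_mul]
  rfl

theorem STB.hasDerivAt_loss {d M n : ℕ} {𝒟 : Type*} {S : STB d M}
    (hS : S.OrthonormalEmbeddings) {act : 𝒟 → Fin M → ℝ} {ℓ : 𝒟 → (Fin n → ℝ) → ℝ}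
    {W : Matrix (Fin d) (Fin n) ℝ} {z : Fin M → ℝ} {p : 𝒟} (hp : S.SmoothAt act ℓ W z p)
    (i : Fin M) (j : Fin n) :
    HasDerivAt
      (fun s : ℝ => ℓ p (S.output (W + s • (S.UC * Matrix.single i j (1 : ℝ))) z (act p)))
      (Real.exp (z i) * (S.backprop act ℓ W z p j * act p i)) 0 := by
  set c := Real.exp (z i) * act p i with hc
  have hout : HasDerivAt
      (fun s : ℝ => S.output (W + s • (S.UC * Matrix.single i j (1 : ℝ))) z (act p))
      ((deriv S.φ (S.preact W z (act p) j) * c) • Pi.single j (1 : ℝ)) 0 := by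
    rw [hasDerivAt_pi]
    intro k
    simp only [STB.output, STB.preact_add_smul hS, Pi.add_apply, Pi.smul_apply, smul_eq_mul,
      ← hc]
    have hline : HasDerivAt
        (fun s : ℝ => S.preact W z (act p) k + s * (Pi.single j c : Fin n → ℝ) k)
        ((Pi.single j c : Fin n → ℝ) k) 0 := by
      simpa using ((hasDerivAt_id (0 : ℝ)).mul_const
        ((Pi.single j c : Fin n → ℝ) k)).const_add (S.preact W z (act p) k)
    have hφ : HasDerivAt S.φ (deriv S.φ (S.preact W z (act p) k))
        (S.preact W z (act p) k + 0 * (Pi.single j c : Fin n → ℝ) k) := by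
      simpa using (hp.1 k).hasDerivAt
    refine (hφ.comp (0 : ℝ) hline).congr_deriv ?_
    by_cases hkj : k = j
    · subst hkj; simp
    · simp [hkj]
  have hℓ : HasFDerivAt (ℓ p) (fderiv ℝ (ℓ p) (S.output W z (act p)))
      (S.output (W + (0 : ℝ) • (S.UC * Matrix.single i j (1 : ℝ))) z (act p)) := by
    simpa using hp.2.hasFDerivAt
  refine (hℓ.comp_hasDerivAt (0 : ℝ) hout).congr_deriv ?_
  rw [map_smul, smul_eq_mul, STB.backprop, hc]
  ring

theorem STB.gradV_row_eq {d M n B : ℕ} {𝒟 : Type*} {S : STB d M}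
    (hS : S.OrthonormalEmbeddings) {act : 𝒟 → Fin M → ℝ} {ℓ : 𝒟 → (Fin n → ℝ) → ℝ}
    {W : Matrix (Fin d) (Fin n) ℝ} {z : Fin M → ℝ} {D : Fin B → 𝒟}
    (hD : ∀ b, S.SmoothAt act ℓ W z (D b)) (i : Fin M) :
    S.gradV act ℓ W z D i = Real.exp (z i) • S.backpropSignal act ℓ W z D i := by
  funext j
  have h := (HasDerivAt.fun_sum (u := Finset.univ)
    fun b _ => STB.hasDerivAt_loss hS (hD b) i j).const_mul ((B : ℝ)⁻¹)
  simp only [STB.gradV, STB.batchLoss, STB.backpropSignal, Matrix.of_apply, Pi.smul_apply,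
    smul_eq_mul]
  rw [h.deriv, ← Finset.mul_sum]
  ring

theorem STB.gradNorm_gradV_row {d M n B : ℕ} {𝒟 : Type*} {S : STB d M}
    (hS : S.OrthonormalEmbeddings) {act : 𝒟 → Fin M → ℝ} {ℓ : 𝒟 → (Fin n → ℝ) → ℝ}
    {W : Matrix (Fin d) (Fin n) ℝ} {z : Fin M → ℝ} {D : Fin B → 𝒟}
    (hD : ∀ b, S.SmoothAt act ℓ W z (D b)) (i : Fin M) :
    gradNorm (S.gradV act ℓ W z D) i = standardize (S.backpropSignal act ℓ W z D i) := by
  rw [gradNorm_row, STB.gradV_row_eq hS hD, standardize_smul (Real.exp_pos _)]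

/-! ### Covariance of identically distributed rows -/

theorem covariance_eq_of_identDistrib {Ω Ω' ι : Type*} [MeasurableSpace Ω] [MeasurableSpace Ω']
    {P : Measure Ω} {Q : Measure Ω'} {X : Ω → ι → ℝ} {Y : Ω' → ι → ℝ}
    (h : IdentDistrib X Y P Q) (j k : ι) :
    covariance (fun ω => X ω j) (fun ω => X ω k) P =
      covariance (fun ω => Y ω j) (fun ω => Y ω k) Q := by
  have hmean (l : ι) : ∫ ω, X ω l ∂P = ∫ ω, Y ω l ∂Q :=
    (h.comp (measurable_pi_apply l)).integral_eq
  rw [covariance, covariance, hmean j, hmean k]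
  have hprod : Measurable fun v : ι → ℝ =>
      (v j - ∫ ω, Y ω j ∂Q) * (v k - ∫ ω, Y ω k ∂Q) := by fun_prop
  exact (h.comp hprod).integral_eq

theorem mainTheorem2
    {Ω : Type*} [MeasurableSpace Ω] (P : Measure Ω) [IsProbabilityMeasure P]
    {T : Type*} {𝒟 : Type*} {d M n B : ℕ}
    (S : STB d M) (hS : S.OrthonormalEmbeddings)
    (act : 𝒟 → Fin M → ℝ) (ℓ : 𝒟 → (Fin n → ℝ) → ℝ)
    -- parameters and mini-batch at time `t`
    (W : T → Ω → Matrix (Fin d) (Fin n) ℝ) (z : T → Ω → Fin M → ℝ) (D : T → Ω → Fin B → 𝒟)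
    (hsmooth : ∀ t, ∀ᵐ ω ∂P, ∀ b, S.SmoothAt act ℓ (W t ω) (z t ω) (D t ω b))
    -- stationary back-propagated gradient with identically distributed mini-batch noise
    (μ : Matrix (Fin M) (Fin n) ℝ) (ξ : T → Ω → Matrix (Fin M) (Fin n) ℝ)
    (hsignal : ∀ t, ∀ᵐ ω ∂P, S.backpropSignal act ℓ (W t ω) (z t ω) (D t ω) = μ + ξ t ω)
    (hnoise : ∀ i t₁ t₂, IdentDistrib (fun ω => ξ t₁ ω i) (fun ω => ξ t₂ ω i) P P) :
    (∀ t i j, MemLp (fun ω => gradNorm (S.gradV act ℓ (W t ω) (z t ω) (D t ω)) i j) 2 P) ∧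
    (∀ t₁ t₂ i,
      rowCov P (fun ω => gradNorm (S.gradV act ℓ (W t₁ ω) (z t₁ ω) (D t₁ ω))) i =
        rowCov P (fun ω => gradNorm (S.gradV act ℓ (W t₂ ω) (z t₂ ω) (D t₂ ω))) i) ∧
    (∀ t i j, MemLp (fun ω => gradNorm (S.gradLogits act ℓ (W t ω) (z t ω) (D t ω)) i j) 2 P) ∧
    (∀ t₁ t₂ i,
      rowCov P (fun ω => gradNorm (S.gradLogits act ℓ (W t₁ ω) (z t₁ ω) (D t₁ ω))) i =
        rowCov P (fun ω => gradNorm (S.gradLogits act ℓ (W t₂ ω) (z t₂ ω) (D t₂ ω))) i) := by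
  have hrow (t : T) (i : Fin M) :
      (fun ω => gradNorm (S.gradV act ℓ (W t ω) (z t ω) (D t ω)) i) =ᵐ[P]
        fun ω => standardize (μ i + ξ t ω i) := by
    filter_upwards [hsmooth t, hsignal t] with ω hD hsig
    rw [STB.gradNorm_gradV_row hS hD, hsig]
    rfl
  have hmeas (i : Fin M) : Measurable fun v : Fin n → ℝ => standardize (μ i + v) :=
    measurable_standardize.comp (measurable_const.add measurable_id)
  have haem (t : T) (i : Fin M) :
      AEMeasurable (fun ω => gradNorm (S.gradV act ℓ (W t ω) (z t ω) (D t ω)) i) P :=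
    ((hmeas i).comp_aemeasurable (hnoise i t t).aemeasurable_fst).congr (hrow t i).symm
  refine ⟨fun t i j => ?_, fun t₁ t₂ i => ?_, fun t i j => ?_, fun t₁ t₂ i => ?_⟩
  · refine MemLp.of_bound (((measurable_pi_apply j).comp_aemeasurable
      (haem t i)).aestronglyMeasurable) (Real.sqrt n) (.of_forall fun ω => ?_)
    rw [Real.norm_eq_abs, gradNorm_row]
    exact abs_standardize_le _ j
  · ext j k
    have hid : IdentDistrib
        (fun ω => gradNorm (S.gradV act ℓ (W t₁ ω) (z t₁ ω) (D t₁ ω)) i)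
        (fun ω => gradNorm (S.gradV act ℓ (W t₂ ω) (z t₂ ω) (D t₂ ω)) i) P P :=
      ((IdentDistrib.of_ae_eq (haem t₁ i) (hrow t₁ i)).trans
        ((hnoise i t₁ t₂).comp (hmeas i))).trans
        (IdentDistrib.of_ae_eq (haem t₂ i) (hrow t₂ i)).symm
    exact covariance_eq_of_identDistrib hid j k
  · simp only [gradNorm_single_column]
    exact MemLp.zero'
  · simp only [gradNorm_single_column]
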